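/- Let $d\ge 2$ and let $n\ge R$ be non-negative integers. For a polynomial $f$ of degree at most $d$ in $n$ variables $x_1,\dots,x_n$ over a field, let $m^{(f)}=(m^{(f)}_1,\dots,m^{(f)}_n)$ be the $n$-tuple of multilinear forms in $d-1$ vectors $x^{(1)},\dots,x^{(d-1)}$ of $n$ variables given by $$m^{(f)}_i\bigl(x^{(1)},\dots,x^{(d-1)}\bigr)=\sum_{j_1,\dots,j_{d-1}=1}^n x^{(1)}_{j_1}\cdots x^{(d-1)}_{j_{d-1}}\,\frac{\partial^d f}{\partial x_{j_1}\cdots\partial x_{j_{d-1}}\partial x_i},$$ and let $J_{m^{(f)}}(x^{(1)},\dots,x^{(d-1)})$ be its $n\times(d-1)n$ Jacobian matrix, whose columns are the partial derivatives of $m^{(f)}$ with respect to the variables $x^{(k)}_j$. For an $R$-tuple $H=(H_1,\dots,H_R)$ of forms of degree $d$ in $n$ variables with coefficients in a field $F$ with algebraic closure $\bar F$, put $$\sigma^*(H)=n-\min_{\beta\in\bar F^R\setminus\{0\}}\ \min_{\substack{x^{(1)},\dots,x^{(d-1)}\in\bar F^n\setminus\{0\}\\ m^{(\beta\cdot H)}(x^{(1)},\dots,x^{(d-1)})=0}}\operatorname{rank}J_{m^{(\beta\cdot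 H)}}\bigl(x^{(1)},\dots,x^{(d-1)}\bigr),$$ where $\beta\cdot H=\sum_r\beta_rH_r$ and a minimum over the empty set is $+\infty$ (so that $\sigma^*(H)=-\infty$ in that case). Regard the space of $R$-tuples of forms of degree $d$ in $n$ variables as an affine space $\mathbb A$ over $\mathbb Q$, whose coordinates are the coefficients of the forms. Then the condition $\sigma^*(H)\le R-1$ defines a nonempty Zariski open set $U_{d,n,R}$ in $\mathbb A$, defined over $\mathbb Q$. That is, there is a nonempty Zariski open subset $U_{d,n,R}$ of the $\mathbb Q$-scheme $\mathbb A$ such that, for every field $F$ of characteristic zero and every $R$-tuple $H$ of forms of degree $d$ in $n$ variables with coefficients in $F$, the $F$-point $H$ of $\mathbb A$ lies in $U_{d,n,R}$ if and only if $\sigma^*(H)\le R-1$. -/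

import Mathlib

universe u

noncomputable section

namespace GeneralPosition

open MvPolynomial

/-- The iterated partial derivative `∂^k f / ∂x_{j_1} ⋯ ∂x_{j_k}`. -/
def iterPderiv {K : Type*} [Field K] {n k : ℕ} (j : Fin k → Fin n)
    (f : MvPolynomial (Fin n) K) : MvPolynomial (Fin n) K :=
  (List.ofFn j).foldr (fun i g => pderiv i g) f

/-- The multilinear form `m_i^{(f)}(x^{(1)}, …, x^{(d-1)})`, as a polynomial in the variables
`x^{(k)}_j`, indexed by pairs `(k, j)`, where `f` is a polynomial of degree (at most) `d`:
`∑_{j_1, …, j_{d-1}} x^{(1)}_{j_1} ⋯ x^{(d-1)}_{j_{d-1}} ∂^d f / ∂x_{j_1} ⋯ ∂x_{j_{d-1}} ∂x_i`.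
The `d`-th order partial derivatives of `f` are constants, and are read off as elements of `K`
by `constantCoeff`. -/
def multilin {K : Type*} [Field K] {n : ℕ} (d : ℕ) (f : MvPolynomial (Fin n) K) (i : Fin n) :
    MvPolynomial (Fin (d - 1) × Fin n) K :=
  ∑ j : Fin (d - 1) → Fin n,
    C (constantCoeff (iterPderiv j (pderiv i f))) * ∏ k : Fin (d - 1), X (k, j k)

/-- The value of `m_i^{(f)}` at vectors `x^{(1)}, …, x^{(d-1)}`. -/
def multilinEval {K : Type*} [Field K] {n : ℕ} (d : ℕ) (f : MvPolynomial (Fin n) K)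
    (x : Fin (d - 1) → Fin n → K) (i : Fin n) : K :=
  eval (fun p : Fin (d - 1) × Fin n => x p.1 p.2) (multilin d f i)

/-- The `n × (d-1)n` Jacobian matrix of the tuple `m^{(f)}`, evaluated at the vectors
`x^{(1)}, …, x^{(d-1)}`. -/
def multilinJacobian {K : Type*} [Field K] {n : ℕ} (d : ℕ) (f : MvPolynomial (Fin n) K)
    (x : Fin (d - 1) → Fin n → K) : Matrix (Fin n) (Fin (d - 1) × Fin n) K :=
  Matrix.of fun i q =>
    eval (fun p : Fin (d - 1) × Fin n => x p.1 p.2) (pderiv q (multilin d f i))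

/-- The form `β · H = ∑_r β_r H_r`, where `β` has entries in an algebraic closure of `F`. -/
def linComb {F : Type*} [Field F] {n R : ℕ} (β : Fin R → AlgebraicClosure F)
    (H : Fin R → MvPolynomial (Fin n) F) : MvPolynomial (Fin n) (AlgebraicClosure F) :=
  ∑ r, C (β r) * map (algebraMap F (AlgebraicClosure F)) (H r)

/-- The quantity `σ*(H)`: `n` minus the least rank of the Jacobian matrix of `m^{(β · H)}` at
`(x^{(1)}, …, x^{(d-1)})`, over all `β ≠ 0` and all nonzero `x^{(1)}, …, x^{(d-1)}` with
coordinates in an algebraic closure for which `m^{(β · H)}(x^{(1)}, …, x^{(d-1)}) = 0`.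
A minimum over the empty set is `+∞`, and then `σ*(H) = -∞`. -/
def sigmaStar {F : Type*} [Field F] {n R : ℕ} (d : ℕ)
    (H : Fin R → MvPolynomial (Fin n) F) : EReal :=
  (n : EReal) -
    ⨅ (β : Fin R → AlgebraicClosure F) (_ : β ≠ 0),
      ⨅ (x : Fin (d - 1) → Fin n → AlgebraicClosure F) (_ : ∀ k, x k ≠ 0)
        (_ : multilinEval d (linComb β H) x = 0),
          ((multilinJacobian d (linComb β H) x).rank : EReal)

/-- The exponents of the monomials of degree `d` in `n` variables. -/
abbrev FormMonomial (n d : ℕ) : Type := {m : Fin n →₀ ℕ // m.degree = d}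

/-- The affine space over `ℚ` of `R`-tuples of forms of degree `d` in `n` variables: the spectrum
of the polynomial ring over `ℚ` with one variable for each coefficient of each form. Its
topology is the Zariski topology. -/
abbrev FormSpace (d n R : ℕ) : Type :=
  PrimeSpectrum (MvPolynomial (Fin R × FormMonomial n d) ℚ)

/-- The point of the affine space of `R`-tuples of degree `d` forms that is given by an
`R`-tuple `H` with coefficients in a field `F` of characteristic zero (the image of the
`F`-point `Spec F → FormSpace d n R`): the polynomials over `ℚ` that vanish at the
coefficients of `H`. -/
def formPoint {F : Type*} [Field F] [CharZero F] {n R : ℕ} (d : ℕ)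
    (H : Fin R → MvPolynomial (Fin n) F) : FormSpace d n R :=
  ⟨RingHom.ker (aeval (R := ℚ)
      (fun p : Fin R × FormMonomial n d => coeff p.2.1 (H p.1))), RingHom.ker_isPrime _⟩

end GeneralPosition

end

/-! Openness is elimination theory. As `R ≤ n`, the inequality `σ*(H) ≤ R - 1` fails exactly when
there are nonzero `β`, `x^{(1)}, …, x^{(d-1)}` over the algebraic closure with `m^{(β·H)}(x) = 0`
and all minors of size `n + 1 - R` of the Jacobian zero (`sigmaStar_le_iff`). These equations are
homogeneous in each of the `d` blocks of variables, so solvability is a closed condition on the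
coefficients of `H`, given by rational polynomials that serve every field (`exists_elimination`).

Nonemptiness is checked at the generic point, where the coefficients `a_p` of `H` are independent
transcendentals and each `∂/∂a_p` extends to a derivation `D` of the algebraic closure. Applying `D`
to `m^{(β·H)}(x) = 0` shows that the derivative of `m` in the direction `a_p` lies in `im T + im J`,
where `T` is `β ↦ m^{(β·H)}(x)` and `J` is the Jacobian. These directions span all `n` dimensions
(`span_tensorForm_eq_top`), and `rank T ≤ R - 1` because `T β = 0`. Hence `rank J ≥ n - R + 1` at
every zero. -/

noncomputable section

namespace GeneralPosition

open MvPolynomial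
open scoped TensorProduct

/-! ### Rank and minors. -/

section LinearAlgebra

variable {K : Type*} [Field K]

theorem exists_det_submatrix_ne_zero_of_span_eq_top {m n : Type*} [Fintype m] [DecidableEq m]
    (M : Matrix m n K) (h : Submodule.span K (Set.range M.col) = ⊤) :
    ∃ e : m → n, (M.submatrix id e).det ≠ 0 := by
  obtain ⟨κ, a, -, hspan, hli⟩ := exists_linearIndependent' K M.col
  rw [h] at hspan
  let b := Module.Basis.mk hli hspan.ge
  have : Finite κ := Module.Finite.finite_basis b
  have : Fintype κ := Fintype.ofFinite κ
  have hc : Fintype.card m = Fintype.card κ := by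
    rw [← Module.finrank_eq_card_basis b, Module.finrank_fintype_fun_eq_card]
  let g := Fintype.equivOfCardEq hc
  refine ⟨a ∘ g, ?_⟩
  have h2 : LinearIndependent K (M.submatrix id (a ∘ g)).col := hli.comp g g.injective
  rw [Matrix.linearIndependent_cols_iff_isUnit, Matrix.isUnit_iff_isUnit_det] at h2
  exact h2.ne_zero

/-- Turns a rank condition into polynomial equations. Injectivity of `e` and `f` is not required,
since a repeated row or column only gives a zero minor. -/
theorem le_rank_iff_exists_det_submatrix_ne_zero {m n : Type*} [Fintype m] [Fintype n]
    (M : Matrix m n K) (s : ℕ) :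
    s ≤ M.rank ↔ ∃ (e : Fin s → m) (f : Fin s → n), (M.submatrix e f).det ≠ 0 := by
  classical
  constructor
  · intro h
    obtain ⟨κ, a, ha, hspan, hli⟩ := exists_linearIndependent' K M.col
    have : Finite κ := Finite.of_injective a ha
    have : Fintype κ := Fintype.ofFinite κ
    have hc : s ≤ Fintype.card κ := by
      rwa [← finrank_span_eq_card hli, hspan, ← Matrix.rank_eq_finrank_span_cols]
    obtain ⟨g⟩ : Nonempty (Fin s ↪ κ) := by
      rw [Function.Embedding.nonempty_iff_card_le]; simpa using hc
    have h2 : LinearIndependent K (M.submatrix id (a ∘ g)).col := hli.comp g g.injective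
    have h3 : (M.submatrix id (a ∘ g)).rank = s := by
      rw [Matrix.rank_eq_finrank_span_cols, finrank_span_eq_card h2, Fintype.card_fin]
    obtain ⟨e, he⟩ := exists_det_submatrix_ne_zero_of_span_eq_top
      (M.submatrix id (a ∘ g)).transpose (by
        apply Submodule.eq_top_of_finrank_eq
        rw [← Matrix.rank_eq_finrank_span_cols, Matrix.rank_transpose, h3]; simp)
    refine ⟨e, a ∘ g, ?_⟩
    rw [← Matrix.det_transpose] at he
    exact he
  · rintro ⟨e, f, h⟩
    have h2 : (M.submatrix e f).rank = s := by
      rw [Matrix.rank_of_isUnit _ ((Matrix.isUnit_iff_isUnit_det _).2 h.isUnit)]; simp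
    exact h2 ▸ M.rank_submatrix_le e f

end LinearAlgebra

/-! ### Multiprojective elimination by Macaulay matrices. -/

section Elimination

variable {σ ι τ : Type*} [DecidableEq ι]

/-- The multigrading for which the variable `X s` has degree one in the block `b s`. -/
def blockWeight (b : σ → ι) (s : σ) : ι → ℕ := Pi.single (b s) 1

theorem le_weight_blockWeight (b : σ → ι) (c : σ →₀ ℕ) (s : σ) :
    c s ≤ Finsupp.weight (blockWeight b) c (b s) := by
  classical
  have : c = Finsupp.single s (c s) + c.erase s := (Finsupp.single_add_erase s c).symm
  conv_rhs => rw [this]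
  simp [Finsupp.weight_single, blockWeight]

/-- The exponents of the monomials that have degree `N` in every block. -/
abbrev BlockExponent (b : σ → ι) (N : ℕ) : Type _ :=
  {c : σ →₀ ℕ // Finsupp.weight (blockWeight b) c = fun _ => N}

instance [Finite σ] (b : σ → ι) (N : ℕ) : Finite (BlockExponent b N) := by
  cases nonempty_fintype σ
  refine Finite.of_injective (β := σ → Fin (N + 1)) (fun c s => ⟨c.1 s, ?_⟩) fun c c' h => ?_
  · have := le_weight_blockWeight b c.1 s
    rw [c.2] at this
    exact Nat.lt_succ_of_le this
  · ext s
    simpa using congrFun h s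

/-- The monomial multiples of the `g t` that have degree `N` in every block,
written in terms of monomials. -/
def macaulayMatrix {A : Type*} [CommRing A] (b : σ → ι) (e : τ → ι → ℕ)
    (g : τ → MvPolynomial σ A) (N : ℕ) :
    Matrix (BlockExponent b N)
      {p : τ × (σ →₀ ℕ) // Finsupp.weight (blockWeight b) p.2 + e p.1 = fun _ => N} A :=
  Matrix.of fun c p => coeff c.1 (monomial p.1.2 1 * g p.1.1)

/-- Pigeonhole: exponents below `M` cannot add up to more than `Nat.card σ * M`. -/
theorem exists_mul_le_of_weight [Finite σ] (b : σ → ι) (M : ℕ) (c : σ →₀ ℕ)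
    (hc : ∀ k, Nat.card σ * M < Finsupp.weight (blockWeight b) c k) (k : ι) :
    ∃ s, b s = k ∧ M ≤ c s := by
  classical
  cases nonempty_fintype σ
  by_contra! h
  refine (hc k).not_ge ?_
  rw [Finsupp.weight_apply, Finsupp.sum_fintype _ _ (by simp), Finset.sum_apply]
  calc _ ≤ ∑ s : σ, M := Finset.sum_le_sum fun s _ => ?_
    _ = _ := by simp
  by_cases hs : b s = k
  · simpa [blockWeight, hs] using (h s hs).le
  · simp [blockWeight, Ne.symm hs]

/-- Every common zero kills a whole block, so by the Nullstellensatz each product of one variable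
per block lies in the radical of the ideal. A monomial of large degree in every block is divisible
by a high power of such a product, hence lies in the ideal. Taking coefficients in multidegree `(N,
…, N)` turns this membership into membership in the column span. -/
theorem macaulayMatrix_span_eq_top [Finite σ] [Finite ι] {K : Type*} [Field K] [IsAlgClosed K]
    (b : σ → ι) (e : τ → ι → ℕ) (g : τ → MvPolynomial σ K)
    (hg : ∀ t, IsWeightedHomogeneous (blockWeight b) (g t) (e t))
    (h : ∀ y : σ → K, (∀ t, eval y (g t) = 0) → ∃ k, ∀ s, b s = k → y s = 0) :
    ∃ N, Submodule.span K (Set.range (macaulayMatrix b e g N).col) = ⊤ := by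
  classical
  cases nonempty_fintype σ
  cases nonempty_fintype ι
  let I : Ideal (MvPolynomial σ K) := Ideal.span (Set.range g)
  have hrad : ∀ s : ι → σ, (∀ k, b (s k) = k) →
      ∃ M, ∀ m ≥ M, (∏ k, X (s k) : MvPolynomial σ K) ^ m ∈ I := by
    intro s hs
    have : (∏ k, X (s k) : MvPolynomial σ K) ∈ I.radical := by
      rw [← vanishingIdeal_zeroLocus_eq_radical (K := K), mem_vanishingIdeal_iff]
      intro y hy
      rw [mem_zeroLocus_iff] at hy
      obtain ⟨k, hk⟩ := h y fun t => by
        simpa [aeval_eq_eval] using hy (g t) (Ideal.subset_span ⟨t, rfl⟩)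
      rw [map_prod]
      exact Finset.prod_eq_zero (Finset.mem_univ k) (by simpa using hk _ (hs k))
    obtain ⟨M, hM⟩ := this
    exact ⟨M, fun m hm => I.pow_mem_of_pow_mem hM hm⟩
  -- There are finitely many choices `s`, so the sum of their exponents serves all of them.
  obtain ⟨M, hM⟩ : ∃ M, ∀ s : ι → σ, (∀ k, b (s k) = k) →
      (∏ k, X (s k) : MvPolynomial σ K) ^ M ∈ I := by
    choose! M hM using hrad
    exact ⟨∑ s, M s, fun s hs => hM s hs _
      (Finset.single_le_sum (f := M) (fun _ _ => Nat.zero_le _) (Finset.mem_univ s))⟩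
  set N := Nat.card σ * M + 1 with hN
  refine ⟨N, ?_⟩
  set V := Submodule.span K (Set.range (macaulayMatrix b e g N).col) with hV
  let π : MvPolynomial σ K →ₗ[K] (BlockExponent b N → K) := LinearMap.pi fun c => lcoeff K c.1
  have hπ : ∀ t q, π (q * g t) ∈ V := by
    intro t q
    induction q using MvPolynomial.induction_on' with
    | monomial a r =>
      have hr : π (monomial a r * g t) = r • π (monomial a 1 * g t) := by
        rw [← map_smul, ← smul_mul_assoc, smul_monomial, smul_eq_mul, mul_one]
      rw [hr]
      refine V.smul_mem _ ?_
      by_cases ha : Finsupp.weight (blockWeight b) a + e t = fun _ => N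
      · exact Submodule.subset_span ⟨⟨(t, a), ha⟩, rfl⟩
      -- A multiple of any other multidegree has no coefficient in multidegree `(N, …, N)`.
      · convert V.zero_mem
        ext c
        refine ((isWeightedHomogeneous_monomial _ _ _ rfl).mul (hg t)).coeff_eq_zero _ ?_
        rw [c.2]
        exact Ne.symm ha
    | add q q' hq hq' => rw [add_mul, map_add]; exact V.add_mem hq hq'
  have hπ : ∀ f ∈ I, π f ∈ V := by
    intro f hf
    obtain ⟨q, rfl⟩ := Finsupp.mem_ideal_span_range_iff_exists_finsupp.1 hf
    rw [Finsupp.sum, map_sum]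
    exact V.sum_mem fun t _ => hπ t _
  rw [eq_top_iff, ← (Pi.basisFun K (BlockExponent b N)).span_eq, Submodule.span_le]
  rintro _ ⟨c, rfl⟩
  choose s hs hsM using exists_mul_le_of_weight b M c.1 (fun k => by rw [c.2]; simp [hN])
  have hmem : (monomial c.1 1 : MvPolynomial σ K) ∈ I := by
    refine I.mem_of_dvd ?_ (hM s hs)
    have hX : (∏ k, X (s k) : MvPolynomial σ K) ^ M =
        monomial (∑ k, Finsupp.single (s k) M) 1 := by
      rw [monomial_sum_one, ← Finset.prod_pow]
      exact Finset.prod_congr rfl fun k _ => X_pow_eq_monomial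
    rw [hX, monomial_one_dvd_monomial_one]
    intro i
    rw [Finsupp.finsetSum_apply]
    rw [Finset.sum_eq_single (b i)]
    · by_cases hi : s (b i) = i
      · rw [Finsupp.single_apply, if_pos hi]
        exact hi ▸ hsM (b i)
      · simp [hi]
    · intro k _ hk
      rw [Finsupp.single_apply, if_neg]
      rintro rfl
      exact hk (hs k).symm
    · simp
  have h1 := hπ _ hmem
  have h2 : π (monomial c.1 1) = Pi.basisFun K _ c := by
    ext c'
    simp [π, Pi.basisFun_apply, Pi.single_apply, coeff_monomial, Subtype.ext_iff, eq_comm]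
  exact h2 ▸ h1

/-- `S` consists of the maximal minors of the Macaulay matrices over `A` for all `N`, so it depends
on neither `K` nor `φ`. Without an admissible zero some Macaulay matrix has full row rank; an
admissible zero gives a nonzero left kernel vector for every `N`. -/
theorem exists_elimination [Finite σ] [Finite ι] {A : Type*} [CommRing A] (b : σ → ι) (e : τ → ι → ℕ)
    (g : τ → MvPolynomial σ A) (hg : ∀ t, IsWeightedHomogeneous (blockWeight b) (g t) (e t)) :
    ∃ S : Set A, ∀ (K : Type u) [Field K] [IsAlgClosed K] (φ : A →+* K),
      (∀ a ∈ S, φ a = 0) ↔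
        ∃ y : σ → K, (∀ k, ∃ s, b s = k ∧ y s ≠ 0) ∧ ∀ t, eval₂ φ y (g t) = 0 := by
  classical
  cases nonempty_fintype ι
  have (N : ℕ) : Fintype (BlockExponent b N) := Fintype.ofFinite _
  refine ⟨{a | ∃ N f, a = ((macaulayMatrix b e g N).submatrix id f).det}, fun K _ _ φ => ?_⟩
  have hmap : ∀ N f, φ ((macaulayMatrix b e g N).submatrix id f).det =
      ((macaulayMatrix b e (fun t => map φ (g t)) N).submatrix id f).det := by
    intro N f
    rw [RingHom.map_det]
    congr 1
    ext c p
    simp [macaulayMatrix, ← coeff_map]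
  constructor
  · intro hS
    by_contra! hy
    obtain ⟨N, hN⟩ := macaulayMatrix_span_eq_top b e (fun t => map φ (g t))
      (fun t c hc => hg t fun h0 => hc (by rw [coeff_map, h0, map_zero])) (fun y hy' => by
          by_contra! hk
          obtain ⟨t, ht⟩ := hy y hk
          exact ht (by rw [← eval_map]; exact hy' t))
    obtain ⟨f, hf⟩ := exists_det_submatrix_ne_zero_of_span_eq_top _ hN
    exact hf (by rw [← hmap]; exact hS _ ⟨N, f, rfl⟩)
  · rintro ⟨y, hy, hgy⟩ _ ⟨N, f, rfl⟩
    rw [hmap]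
    by_contra hdet
    choose s hs hys using hy
    -- The values at `y` of the monomials: pairing `v` with a column evaluates a multiple of some `g
    -- t` at `y`, which gives zero.
    let v : BlockExponent b N → K := fun c => c.1.prod fun i n => y i ^ n
    have hv : Matrix.vecMul v
        ((macaulayMatrix b e (fun t => map φ (g t)) N).submatrix id f) = 0 := by
      ext p
      obtain ⟨⟨⟨t, a⟩, hp⟩, hq⟩ : ∃ q, f p = q := ⟨_, rfl⟩
      set P : MvPolynomial σ K := monomial a 1 * map φ (g t) with hP
      have hPw : IsWeightedHomogeneous (blockWeight b) P (fun _ => N) := hp ▸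
        (isWeightedHomogeneous_monomial _ _ _ rfl).mul
          fun c hc => hg t fun h0 => hc (by rw [coeff_map, h0, map_zero])
      have hP0 : eval y P = 0 := by rw [hP, map_mul, eval_map, hgy, mul_zero]
      rw [Pi.zero_apply, ← hP0, eval_eq]
      trans ∑ d ∈ (Finset.univ : Finset (BlockExponent b N)).map (Function.Embedding.subtype _),
        coeff d P * ∏ i ∈ d.support, y i ^ d i
      · rw [Finset.sum_map, Matrix.vecMul, dotProduct]
        refine Finset.sum_congr rfl fun c _ => ?_
        simp [v, macaulayMatrix, hq, hP, Finsupp.prod, mul_comm]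
      · refine (Finset.sum_subset (fun d hd => ?_) fun d _ hd => ?_).symm
        · simpa using hPw (mem_support_iff.1 hd)
        · rw [notMem_support_iff.1 hd, zero_mul]
    have hv0 := Matrix.eq_zero_of_vecMul_eq_zero hdet hv
    -- The entry of `v` at `∏ X (s k) ^ N` is nonzero by the choice of `s`.
    have h0 := congrFun hv0 ⟨∑ k, Finsupp.single (s k) N, by
      ext k
      simp [Finsupp.weight_single, blockWeight, hs, Finset.sum_apply, Pi.single_apply]⟩
    refine Finset.prod_ne_zero_iff.2 (fun k (_ : k ∈ Finset.univ) => pow_ne_zero N (hys k)) ?_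
    refine Eq.trans ?_ h0
    simp only [v]
    rw [← Finsupp.prod_finsetSum_index (by simp) (by simp [pow_add])]
    simp

end Elimination

/-! ### Coefficients and Jacobian of the multilinear forms. -/

section Derivatives

variable {n : ℕ}

/-- The composition of the partial derivatives in the directions of a list, as a linear map. -/
def listPderiv {K : Type*} [Field K] (l : List (Fin n)) :
    MvPolynomial (Fin n) K →ₗ[K] MvPolynomial (Fin n) K :=
  l.foldr (fun i g => (pderiv i).toLinearMap ∘ₗ g) LinearMap.id

theorem listPderiv_cons {K : Type*} [Field K] (i : Fin n) (l : List (Fin n))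
    (f : MvPolynomial (Fin n) K) : listPderiv (i :: l) f = pderiv i (listPderiv l f) := rfl

theorem listPderiv_map {K L : Type*} [Field K] [Field L] (φ : K →+* L) (l : List (Fin n))
    (f : MvPolynomial (Fin n) K) : listPderiv l (map φ f) = map φ (listPderiv l f) := by
  induction l with
  | nil => rfl
  | cons i l ih => rw [listPderiv_cons, listPderiv_cons, ih, pderiv_map]

theorem iterPderiv_eq_listPderiv {K : Type*} [Field K] {k : ℕ} (J : Fin k → Fin n)
    (f : MvPolynomial (Fin n) K) : iterPderiv J f = listPderiv (List.ofFn J) f := by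
  rw [iterPderiv]
  induction List.ofFn J with
  | nil => rfl
  | cons i l ih => rw [List.foldr_cons, listPderiv_cons, ih]

/-- The coefficient of `∏ x^{(k)}_{J k}` in `m_i^{(f)}`, as a linear form in `f`. -/
def tensorCoeff {K : Type*} [Field K] {k : ℕ} (J : Fin k → Fin n) (i : Fin n) :
    MvPolynomial (Fin n) K →ₗ[K] K :=
  lcoeff K 0 ∘ₗ listPderiv (List.ofFn J) ∘ₗ (pderiv i).toLinearMap

theorem constantCoeff_iterPderiv {K : Type*} [Field K] {k : ℕ} (J : Fin k → Fin n) (i : Fin n)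
    (f : MvPolynomial (Fin n) K) :
    constantCoeff (iterPderiv J (pderiv i f)) = tensorCoeff J i f := by
  rw [iterPderiv_eq_listPderiv]; rfl

theorem tensorCoeff_map {K L : Type*} [Field K] [Field L] (φ : K →+* L) {k : ℕ}
    (J : Fin k → Fin n) (i : Fin n) (f : MvPolynomial (Fin n) K) :
    tensorCoeff J i (map φ f) = φ (tensorCoeff J i f) := by
  simp only [tensorCoeff, LinearMap.comp_apply, Derivation.coeFn_coe, pderiv_map, listPderiv_map]
  exact coeff_map _ _ _

theorem multilinEval_eq_sum {K : Type*} [Field K] (d : ℕ) (f : MvPolynomial (Fin n) K)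
    (x : Fin (d - 1) → Fin n → K) (i : Fin n) :
    multilinEval d f x i = ∑ J : Fin (d - 1) → Fin n, tensorCoeff J i f * ∏ k, x k (J k) := by
  simp [multilinEval, multilin, constantCoeff_iterPderiv]

theorem _root_.Derivation.leibniz_finset_prod {R A M κ : Type*} [CommSemiring R] [CommSemiring A]
    [AddCommMonoid M] [Algebra R A] [Module A M] [Module R M] [DecidableEq κ]
    (D : Derivation R A M) (s : Finset κ) (f : κ → A) :
    D (∏ k ∈ s, f k) = ∑ k ∈ s, (∏ l ∈ s.erase k, f l) • D (f k) := by
  induction s using Finset.induction_on with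
  | empty => simp
  | insert a s ha ih =>
    rw [Finset.prod_insert ha, D.leibniz, ih, Finset.sum_insert ha, Finset.erase_insert ha,
      add_comm, Finset.smul_sum]
    congr 1
    refine Finset.sum_congr rfl fun k hk => ?_
    have hak : a ≠ k := by rintro rfl; exact ha hk
    rw [Finset.erase_insert_of_ne hak, Finset.prod_insert (by simp [ha]), mul_smul]

theorem prod_update_single {B κ : Type*} [CommRing B] [Fintype κ] [DecidableEq κ]
    (x : κ → Fin n → B) (k : κ) (j : Fin n) (J : κ → Fin n) :
    ∏ l, Function.update x k (Pi.single j 1) l (J l) =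
      (∏ l ∈ Finset.univ.erase k, x l (J l)) * if J k = j then 1 else 0 := by
  rw [← Finset.prod_erase_mul _ _ (Finset.mem_univ k)]
  congr 1
  · refine Finset.prod_congr rfl fun l hl => ?_
    rw [Function.update_of_ne (Finset.ne_of_mem_erase hl)]
  · simp [Pi.single_apply]

/-- By linearity in each vector, differentiating in `x^{(k)}_j` amounts to replacing `x^{(k)}` by
the basis vector `e_j`. -/
theorem multilinJacobian_eq {K : Type*} [Field K] (d : ℕ) (f : MvPolynomial (Fin n) K)
    (x : Fin (d - 1) → Fin n → K) (i : Fin n) (q : Fin (d - 1) × Fin n) :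
    multilinJacobian d f x i q =
      multilinEval d f (Function.update x q.1 (Pi.single q.2 1)) i := by
  classical
  rw [multilinEval_eq_sum, multilinJacobian, Matrix.of_apply, multilin, map_sum, map_sum]
  refine Finset.sum_congr rfl fun J _ => ?_
  rw [pderiv_C_mul, constantCoeff_iterPderiv, map_mul, eval_C, prod_update_single,
    Derivation.leibniz_finset_prod, map_sum, Finset.sum_eq_single q.1]
  · by_cases h : J q.1 = q.2
    · simp [h, map_prod]
    · simp [h, pderiv_X, Prod.ext_iff]
  · intro k _ hk
    simp [pderiv_X, Prod.ext_iff, hk]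
  · simp

end Derivatives

/-! ### The universal equations over `ℚ` and their elimination. -/

section Universal

variable {d n R : ℕ}

instance : Finite (FormMonomial n d) := (Finsupp.finite_of_degree_eq d).to_subtype

instance : Fintype (FormMonomial n d) := Fintype.ofFinite _

/-- The values of the multilinear forms `m_i^{(β · H)}`, in terms of the coefficients `a` of `H`,
over an arbitrary algebra over `ℚ`. -/
def tensorForm {B : Type*} [CommRing B] [Algebra ℚ B] (a : Fin R × FormMonomial n d → B)
    (β : Fin R → B) (x : Fin (d - 1) → Fin n → B) (i : Fin n) : B :=
  ∑ r, ∑ m : FormMonomial n d, ∑ J : Fin (d - 1) → Fin n,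
    algebraMap ℚ B (tensorCoeff J i (monomial m.1 1)) * a (r, m) * β r * ∏ k, x k (J k)

/-- The Jacobian matrix of the multilinear forms `m_i^{(β · H)}`, in terms of the coefficients `a`
of `H`. -/
def tensorJacobian {B : Type*} [CommRing B] [Algebra ℚ B] (a : Fin R × FormMonomial n d → B)
    (β : Fin R → B) (x : Fin (d - 1) → Fin n → B) : Matrix (Fin n) (Fin (d - 1) × Fin n) B :=
  Matrix.of fun i q => tensorForm a β (Function.update x q.1 (Pi.single q.2 1)) i

theorem map_tensorForm {B B' : Type*} [CommRing B] [Algebra ℚ B] [CommRing B'] [Algebra ℚ B']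
    (ψ : B →+* B') (a : Fin R × FormMonomial n d → B)
    (β : Fin R → B) (x : Fin (d - 1) → Fin n → B) (i : Fin n) :
    ψ (tensorForm a β x i) =
      tensorForm (fun p => ψ (a p)) (fun r => ψ (β r)) (fun k j => ψ (x k j)) i := by
  simp only [tensorForm, map_sum, map_mul, map_prod]
  have h : ∀ q : ℚ, ψ (algebraMap ℚ B q) = algebraMap ℚ B' q := fun q =>
    RingHom.congr_fun (Subsingleton.elim (ψ.comp (algebraMap ℚ B)) (algebraMap ℚ B')) q
  simp only [h]

theorem map_tensorJacobian {B B' : Type*} [CommRing B] [Algebra ℚ B] [CommRing B'] [Algebra ℚ B']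
    (ψ : B →+* B') (a : Fin R × FormMonomial n d → B)
    (β : Fin R → B) (x : Fin (d - 1) → Fin n → B) (i : Fin n) (q : Fin (d - 1) × Fin n) :
    ψ (tensorJacobian a β x i q) =
      tensorJacobian (fun p => ψ (a p)) (fun r => ψ (β r)) (fun k j => ψ (x k j)) i q := by
  rw [tensorJacobian, tensorJacobian, Matrix.of_apply, Matrix.of_apply, map_tensorForm]
  congr 1
  ext k j
  by_cases hk : k = q.1
  · subst hk
    simp [Pi.single_apply, apply_ite ψ]
  · simp [Function.update_of_ne hk]

theorem multilinEval_eq_tensorForm {K : Type*} [Field K] [Algebra ℚ K]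
    (f : Fin R → MvPolynomial (Fin n) K)
    (hf : ∀ r, (f r).IsHomogeneous d) (β : Fin R → K) (x : Fin (d - 1) → Fin n → K) (i : Fin n) :
    multilinEval d (∑ r, C (β r) * f r) x i =
      tensorForm (fun p => coeff p.2.1 (f p.1)) β x i := by
  have hsum : ∀ r, f r = ∑ m : FormMonomial n d,
      coeff m.1 (f r) • map (algebraMap ℚ K) (monomial m.1 (1 : ℚ)) := by
    intro r
    ext c
    simp only [map_monomial, map_one, coeff_sum, coeff_smul, coeff_monomial, smul_eq_mul, mul_ite,
      mul_one, mul_zero]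
    by_cases hc : c.degree = d
    · rw [Finset.sum_eq_single ⟨c, hc⟩]
      · simp
      · intro m _ hm
        rw [if_neg fun h => hm (Subtype.ext h)]
      · simp
    · rw [(hf r).coeff_eq_zero hc, Finset.sum_eq_zero]
      intro m _
      rw [if_neg]
      rintro rfl
      exact hc m.2
  have hcoeff : ∀ J : Fin (d - 1) → Fin n, tensorCoeff J i (∑ r, C (β r) * f r) =
      ∑ r, ∑ m : FormMonomial n d,
        algebraMap ℚ K (tensorCoeff J i (monomial m.1 1)) * coeff m.1 (f r) * β r := by
    intro J
    rw [map_sum]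
    refine Finset.sum_congr rfl fun r _ => ?_
    conv_lhs => rw [← smul_eq_C_mul, map_smul, hsum r, map_sum]
    rw [Finset.smul_sum]
    refine Finset.sum_congr rfl fun m _ => ?_
    rw [map_smul, tensorCoeff_map, smul_eq_mul, smul_eq_mul]
    ring
  rw [multilinEval_eq_sum, tensorForm]
  simp only [hcoeff, Finset.sum_mul]
  rw [Finset.sum_comm]
  exact Finset.sum_congr rfl fun r _ => Finset.sum_comm

theorem isWeightedHomogeneous_tensorForm {A σ M : Type*} [CommRing A] [Algebra ℚ A]
    [AddCommMonoid M] (w : σ → M)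
    (a : Fin R × FormMonomial n d → MvPolynomial σ A) (β : Fin R → MvPolynomial σ A)
    (x : Fin (d - 1) → Fin n → MvPolynomial σ A) (u : M) (v : Fin (d - 1) → M)
    (ha : ∀ p, IsWeightedHomogeneous w (a p) 0) (hβ : ∀ r, IsWeightedHomogeneous w (β r) u)
    (hx : ∀ k j, IsWeightedHomogeneous w (x k j) (v k)) (i : Fin n) :
    IsWeightedHomogeneous w (tensorForm a β x i) (u + ∑ k, v k) := by
  refine .sum _ _ _ fun r _ => .sum _ _ _ fun m _ => .sum _ _ _ fun J _ => ?_
  refine .mul ?_ (.prod _ _ _ fun k _ => hx k _)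
  rw [← zero_add u, ← zero_add (0 + u), ← add_assoc]
  rw [IsScalarTower.algebraMap_apply ℚ A (MvPolynomial σ A), algebraMap_eq]
  exact ((isWeightedHomogeneous_C _ _).mul (ha _)).mul (hβ r)

/-- A derivative in the block `q.1` no longer involves that block, so its weight there becomes zero.
-/
theorem isWeightedHomogeneous_tensorJacobian {A σ M : Type*} [CommRing A] [Algebra ℚ A]
    [AddCommMonoid M] (w : σ → M)
    (a : Fin R × FormMonomial n d → MvPolynomial σ A) (β : Fin R → MvPolynomial σ A)
    (x : Fin (d - 1) → Fin n → MvPolynomial σ A) (u : M) (v : Fin (d - 1) → M)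
    (ha : ∀ p, IsWeightedHomogeneous w (a p) 0) (hβ : ∀ r, IsWeightedHomogeneous w (β r) u)
    (hx : ∀ k j, IsWeightedHomogeneous w (x k j) (v k)) (i : Fin n) (q : Fin (d - 1) × Fin n) :
    IsWeightedHomogeneous w (tensorJacobian a β x i q)
      (u + ∑ k, Function.update v q.1 0 k) := by
  refine isWeightedHomogeneous_tensorForm w _ _ _ _ _ ha hβ (fun k j => ?_) i
  by_cases hk : k = q.1
  · subst hk
    simp only [Function.update_self, Pi.single_apply]
    split_ifs
    · exact isWeightedHomogeneous_one _ _
    · exact isWeightedHomogeneous_zero _ _ _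
  · simpa [Function.update_of_ne hk] using hx k j

/-- The weight of an entry depends only on its column, so every permutation contributes a term of
the same weight. -/
theorem _root_.MvPolynomial.IsWeightedHomogeneous.det {A σ M κ : Type*} [CommRing A]
    [AddCommMonoid M] [Fintype κ] [DecidableEq κ] {w : σ → M}
    {P : Matrix κ κ (MvPolynomial σ A)} {u : κ → M}
    (h : ∀ i j, IsWeightedHomogeneous w (P i j) (u j)) :
    IsWeightedHomogeneous w P.det (∑ j, u j) := by
  rw [Matrix.det_apply']
  refine .sum _ _ _ fun g _ => ?_
  rw [← zero_add (∑ j, u j)]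
  refine .mul ?_ (.prod _ _ _ fun j _ => h _ _)
  simpa using isWeightedHomogeneous_C (R := A) w ((Equiv.Perm.sign g : ℤ) : A)

/-- The tuples of forms with coefficients `a` for which some `m^{(β · H)}` has a zero at which
its Jacobian matrix has rank less than `s`. -/
def HasDegenerateZero {K : Type*} [Field K] [Algebra ℚ K] (s : ℕ)
    (a : Fin R × FormMonomial n d → K) : Prop :=
  ∃ (β : Fin R → K) (x : Fin (d - 1) → Fin n → K), β ≠ 0 ∧ (∀ k, x k ≠ 0) ∧
    tensorForm a β x = 0 ∧ (tensorJacobian a β x).rank < s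

theorem exists_elimination_hasDegenerateZero (d n R s : ℕ) :
    ∃ S : Set (MvPolynomial (Fin R × FormMonomial n d) ℚ),
      ∀ (K : Type u) [Field K] [IsAlgClosed K] [Algebra ℚ K] (a : Fin R × FormMonomial n d → K),
        (∀ p ∈ S, aeval a p = 0) ↔ HasDegenerateZero s a := by
  let A := MvPolynomial (Fin R × FormMonomial n d) ℚ
  let σ := Fin R ⊕ (Fin (d - 1) × Fin n)
  -- The block `none` holds `β` and the block `some k` holds the `k`-th vector; a zero with no block
  -- identically zero is then exactly a choice of nonzero `β` and nonzero vectors.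
  let b : σ → Option (Fin (d - 1)) := Sum.elim (fun _ => none) fun p => some p.1
  let a₀ : Fin R × FormMonomial n d → MvPolynomial σ A := fun p => C (X p)
  let β₀ : Fin R → MvPolynomial σ A := fun r => X (Sum.inl r)
  let x₀ : Fin (d - 1) → Fin n → MvPolynomial σ A := fun k j => X (Sum.inr (k, j))
  let u : Option (Fin (d - 1)) → ℕ := Pi.single none 1
  let v : Fin (d - 1) → Option (Fin (d - 1)) → ℕ := fun k => Pi.single (some k) 1
  let g : Fin n ⊕ ((Fin s → Fin n) × (Fin s → Fin (d - 1) × Fin n)) → MvPolynomial σ A :=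
    Sum.elim (tensorForm a₀ β₀ x₀) fun p => ((tensorJacobian a₀ β₀ x₀).submatrix p.1 p.2).det
  have ha : ∀ p, IsWeightedHomogeneous (blockWeight b) (a₀ p) 0 := fun p =>
    isWeightedHomogeneous_C _ _
  have hβ : ∀ r, IsWeightedHomogeneous (blockWeight b) (β₀ r) u := fun r =>
    isWeightedHomogeneous_X _ _ _
  have hx : ∀ k j, IsWeightedHomogeneous (blockWeight b) (x₀ k j) (v k) := fun k j =>
    isWeightedHomogeneous_X _ _ _
  obtain ⟨S, hS⟩ := exists_elimination.{u} b (Sum.elim (fun _ => u + ∑ k, v k)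
      fun p => ∑ j, (u + ∑ k, Function.update v (p.2 j).1 0 k)) g (by
    rintro (i | p)
    · exact isWeightedHomogeneous_tensorForm _ _ _ _ _ _ ha hβ hx i
    · exact .det fun i j => isWeightedHomogeneous_tensorJacobian _ _ _ _ _ _ ha hβ hx _ _)
  refine ⟨S, fun K _ _ _ a => ?_⟩
  rw [show (∀ p ∈ S, aeval a p = 0) ↔ ∀ p ∈ S, (aeval a : A →ₐ[ℚ] K).toRingHom p = 0 from Iff.rfl,
    hS]
  have hform : ∀ (y : σ → K) i, eval₂ (aeval a : A →ₐ[ℚ] K).toRingHom y (tensorForm a₀ β₀ x₀ i) =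
      tensorForm a (fun r => y (Sum.inl r)) (fun k j => y (Sum.inr (k, j))) i := by
    intro y i
    rw [← coe_eval₂Hom, map_tensorForm]
    simp [a₀, β₀, x₀]
  have hdet : ∀ (y : σ → K) (e : Fin s → Fin n) f, eval₂ (aeval a : A →ₐ[ℚ] K).toRingHom y
      ((tensorJacobian a₀ β₀ x₀).submatrix e f).det =
      ((tensorJacobian a (fun r => y (Sum.inl r))
        (fun k j => y (Sum.inr (k, j)))).submatrix e f).det := by
    intro y e f
    rw [← coe_eval₂Hom, RingHom.map_det]
    congr 1
    ext i q
    rw [RingHom.mapMatrix_apply, Matrix.map_apply, Matrix.submatrix_apply, map_tensorJacobian]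
    simp [a₀, β₀, x₀]
  have hrank : ∀ M : Matrix (Fin n) (Fin (d - 1) × Fin n) K, M.rank < s ↔
      ∀ (e : Fin s → Fin n) f, (M.submatrix e f).det = 0 := by
    intro M
    rw [← not_le, le_rank_iff_exists_det_submatrix_ne_zero]
    push Not
    rfl
  simp only [HasDegenerateZero, hrank, Function.ne_iff]
  constructor
  · rintro ⟨y, hy, hg⟩
    refine ⟨fun r => y (Sum.inl r), fun k j => y (Sum.inr (k, j)), ?_, ?_, ?_, ?_⟩
    · obtain ⟨r | p, h, hr⟩ := hy none
      · exact ⟨r, hr⟩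
      · simp [b] at h
    · intro k
      obtain ⟨r | ⟨k', j⟩, h, hr⟩ := hy (some k)
      · simp [b] at h
      · obtain rfl : k' = k := by simpa [b] using h
        exact ⟨j, hr⟩
    · ext i
      rw [← hform]
      exact hg (Sum.inl i)
    · intro e f
      rw [← hdet]
      exact hg (Sum.inr (e, f))
  · rintro ⟨β, x, ⟨r, hr⟩, hx0, hform0, hdet0⟩
    refine ⟨Sum.elim β fun p => x p.1 p.2, ?_, ?_⟩
    · rintro (_ | k)
      · exact ⟨Sum.inl r, rfl, hr⟩
      · obtain ⟨j, hj⟩ := hx0 k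
        exact ⟨Sum.inr (k, j), rfl, hj⟩
    · rintro (i | ⟨e, f⟩)
      · exact (hform _ i).trans (congrFun hform0 i)
      · exact (hdet _ e f).trans (hdet0 e f)

end Universal

/-! ### Derivations of the algebraic closure of a rational function field. -/

section ExtendDerivation

/-- For `L` formally étale over `A`, the differentials of `L` are `L ⊗[A] Ω[A⁄k]`, so a derivation
of `A` extends by base change of its linear map on differentials. -/
theorem exists_derivation_extension (k : Type*) {A L : Type*} [CommRing k] [CommRing A] [CommRing L]
    [Algebra k A] [Algebra k L] [Algebra A L] [IsScalarTower k A L] [Algebra.FormallyEtale A L]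
    (D₀ : Derivation k A A) :
    ∃ D : Derivation k L L, ∀ f, D (algebraMap A L f) = algebraMap A L (D₀ f) := by
  let φ : L ⊗[A] Ω[A⁄k] →ₗ[L] L :=
    (Algebra.linearMap A L ∘ₗ D₀.liftKaehlerDifferential).liftBaseChange L
  refine ⟨(φ ∘ₗ (KaehlerDifferential.tensorKaehlerEquivOfFormallyEtale k A L).symm.toLinearMap).compDer
    (KaehlerDifferential.D k L), fun f => ?_⟩
  change φ ((KaehlerDifferential.tensorKaehlerEquivOfFormallyEtale k A L).symm
    (KaehlerDifferential.D k L (algebraMap A L f))) = _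
  rw [KaehlerDifferential.tensorKaehlerEquivOfFormallyEtale_symm_D_algebraMap]
  simp [φ]

/-- Extends `∂/∂X_p`: localization is formally étale, and so is the algebraic closure, being
separable in characteristic zero. -/
theorem exists_derivation_dual_to_coordinate (τ : Type*) [DecidableEq τ] (p : τ) :
    ∃ D : Derivation ℚ (AlgebraicClosure (FractionRing (MvPolynomial τ ℚ)))
        (AlgebraicClosure (FractionRing (MvPolynomial τ ℚ))),
      ∀ q, D (algebraMap (MvPolynomial τ ℚ) _ (X q)) = Pi.single (M := fun _ => _) p 1 q := by
  have : Algebra.FormallyEtale (MvPolynomial τ ℚ) (FractionRing (MvPolynomial τ ℚ)) :=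
    .of_isLocalization (nonZeroDivisors _)
  have : Algebra.FormallyEtale (FractionRing (MvPolynomial τ ℚ))
      (AlgebraicClosure (FractionRing (MvPolynomial τ ℚ))) := .of_isSeparable _ _
  have : Algebra.FormallyEtale (MvPolynomial τ ℚ)
      (AlgebraicClosure (FractionRing (MvPolynomial τ ℚ))) :=
    .comp _ (FractionRing (MvPolynomial τ ℚ)) _
  obtain ⟨D, hD⟩ := exists_derivation_extension ℚ
    (L := AlgebraicClosure (FractionRing (MvPolynomial τ ℚ))) (pderiv (R := ℚ) p)
  refine ⟨D, fun q => ?_⟩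
  rw [hD, pderiv_X, Pi.single_apply, Pi.single_apply]
  split_ifs <;> simp

end ExtendDerivation

/-! ### Powers of linear forms. -/

section LinearFormPower

variable {n : ℕ} {K : Type*} [Field K]

/-- The linear form with coefficients `a`. -/
def linearForm (a : Fin n → K) : MvPolynomial (Fin n) K := ∑ j, C (a j) * X j

theorem isHomogeneous_linearForm_pow (a : Fin n → K) (d : ℕ) :
    (linearForm a ^ d).IsHomogeneous d := by
  have h : (linearForm a).IsHomogeneous 1 :=
    .sum _ _ _ fun j _ => by simpa using (isHomogeneous_C _ _).mul (isHomogeneous_X K j)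
  simpa using h.pow d

theorem pderiv_linearForm_pow (a : Fin n → K) (i : Fin n) (e : ℕ) :
    pderiv i (linearForm a ^ e) = C (e * a i) * linearForm a ^ (e - 1) := by
  have h : pderiv i (linearForm a) = C (a i) := by
    simp [linearForm, pderiv_X, Pi.single_apply]
  rw [Derivation.leibniz_pow, h]
  simp only [nsmul_eq_mul, smul_eq_mul, map_mul, map_natCast]
  ring

theorem listPderiv_linearForm_pow (a : Fin n → K) (l : List (Fin n)) (e : ℕ) :
    listPderiv l (linearForm a ^ e) =
      C ((e.descFactorial l.length : K) * (l.map a).prod) * linearForm a ^ (e - l.length) := by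
  induction l with
  | nil => simp [listPderiv]
  | cons i l ih =>
    rw [listPderiv_cons, ih, pderiv_C_mul, pderiv_linearForm_pow, ← mul_assoc, ← C_mul,
      List.length_cons, Nat.descFactorial_succ, Nat.sub_sub]
    congr 2
    simp only [List.map_cons, List.prod_cons, Nat.cast_mul]
    ring

theorem tensorCoeff_linearForm_pow (a : Fin n → K) {k : ℕ} (J : Fin k → Fin n) (i : Fin n) :
    tensorCoeff J i (linearForm a ^ (k + 1)) = (k + 1).factorial * a i * ∏ l, a (J l) := by
  simp only [tensorCoeff, LinearMap.comp_apply, Derivation.coeFn_coe, pderiv_linearForm_pow,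
    add_tsub_cancel_right, ← smul_eq_C_mul, map_smul, listPderiv_linearForm_pow]
  simp [Nat.factorial_succ, List.prod_ofFn, List.map_ofFn, Nat.descFactorial_self]
  ring

theorem multilinEval_linearForm_pow {d : ℕ} (hd : 1 ≤ d) (a : Fin n → K)
    (x : Fin (d - 1) → Fin n → K) (i : Fin n) :
    multilinEval d (linearForm a ^ d) x i = d.factorial * a i * ∏ k, ∑ j, a j * x k j := by
  obtain ⟨k, rfl⟩ := Nat.exists_eq_add_of_le' hd
  rw [multilinEval_eq_sum, Finset.prod_univ_sum, Finset.mul_sum, Fintype.piFinset_univ]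
  refine Finset.sum_congr rfl fun J _ => ?_
  rw [Finset.prod_mul_distrib, ← mul_assoc]
  congr 1
  exact tensorCoeff_linearForm_pow a J i

/-- A finite product of nonzero linear forms is a nonzero polynomial, hence is nonzero at some point
over an infinite field. -/
theorem exists_forall_sum_mul_ne_zero [Infinite K] {κ : Type*} [Fintype κ] (v : κ → Fin n → K)
    (hv : ∀ k, v k ≠ 0) : ∃ a : Fin n → K, ∀ k, ∑ j, a j * v k j ≠ 0 := by
  have hne : ∀ k, linearForm (v k) ≠ 0 := by
    intro k h
    obtain ⟨j, hj⟩ := Function.ne_iff.1 (hv k)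
    refine hj ?_
    have := congrArg (eval (Pi.single j 1)) h
    simpa [linearForm, Pi.single_apply] using this
  by_contra! h
  refine Finset.prod_ne_zero_iff.2 (fun k (_ : k ∈ Finset.univ) => hne k) ?_
  refine MvPolynomial.funext fun a => ?_
  obtain ⟨k, hk⟩ := h a
  rw [map_prod, map_zero]
  refine Finset.prod_eq_zero (Finset.mem_univ k) ?_
  simpa [linearForm, mul_comm] using hk

end LinearFormPower

/-! ### Absence of degenerate zeros at the generic point. -/

section GenericPoint

variable {d n R : ℕ} {K : Type*} [Field K] [Algebra ℚ K]

theorem tensorForm_eq_sum_coeff (a : Fin R × FormMonomial n d → K) (β : Fin R → K)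
    (x : Fin (d - 1) → Fin n → K) (i : Fin n) :
    tensorForm a β x i = ∑ p, a p * tensorForm (Pi.single p 1) β x i := by
  have h : ∀ p : Fin R × FormMonomial n d, tensorForm (Pi.single p 1) β x i =
      ∑ J : Fin (d - 1) → Fin n,
        algebraMap ℚ K (tensorCoeff J i (monomial p.2.1 1)) * β p.1 * ∏ k, x k (J k) := by
    intro p
    rw [tensorForm, Finset.sum_eq_single p.1, Finset.sum_eq_single p.2]
    · simp
    · intro m _ hm
      simp [Prod.ext_iff, hm]
    · simp
    · intro r _ hr
      simp [Prod.ext_iff, hr]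
    · simp
  rw [tensorForm, Fintype.sum_prod_type]
  refine Finset.sum_congr rfl fun r _ => Finset.sum_congr rfl fun m _ => ?_
  rw [h, Finset.mul_sum]
  refine Finset.sum_congr rfl fun J _ => ?_
  ring

/-- The values of the multilinear forms as a linear function of `β`. -/
def tensorFormLinear (a : Fin R × FormMonomial n d → K) (x : Fin (d - 1) → Fin n → K) :
    (Fin R → K) →ₗ[K] (Fin n → K) where
  toFun β := tensorForm a β x
  map_add' β β' := by
    ext i
    simp [tensorForm, mul_add, add_mul, Finset.sum_add_distrib]
  map_smul' c β := by
    ext i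
    simp only [tensorForm, Pi.smul_apply, smul_eq_mul, Finset.mul_sum, RingHom.id_apply]
    refine Finset.sum_congr rfl fun r _ => Finset.sum_congr rfl fun m _ =>
      Finset.sum_congr rfl fun J _ => ?_
    ring

theorem derivation_tensorForm (D : Derivation ℚ K K) (a : Fin R × FormMonomial n d → K)
    (β : Fin R → K) (x : Fin (d - 1) → Fin n → K) (i : Fin n) :
    D (tensorForm a β x i) = tensorForm (fun p => D (a p)) β x i +
      tensorForm a (fun r => D (β r)) x i +
      ∑ q, tensorJacobian a β x i q * D (x q.1 q.2) := by
  have hJ : ∑ q, tensorJacobian a β x i q * D (x q.1 q.2) =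
      ∑ r, ∑ m : FormMonomial n d, ∑ J : Fin (d - 1) → Fin n,
        algebraMap ℚ K (tensorCoeff J i (monomial m.1 1)) * a (r, m) * β r *
          ∑ k, (∏ l ∈ Finset.univ.erase k, x l (J l)) * D (x k (J k)) := by
    simp only [tensorJacobian, Matrix.of_apply, tensorForm, Finset.sum_mul]
    rw [Finset.sum_comm]
    refine Finset.sum_congr rfl fun r _ => ?_
    rw [Finset.sum_comm]
    refine Finset.sum_congr rfl fun m _ => ?_
    rw [Finset.sum_comm]
    refine Finset.sum_congr rfl fun J _ => ?_
    rw [Fintype.sum_prod_type, Finset.mul_sum]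
    refine Finset.sum_congr rfl fun k _ => ?_
    simp [prod_update_single, mul_assoc]
  rw [hJ]
  simp only [tensorForm, map_sum, ← Finset.sum_add_distrib]
  refine Finset.sum_congr rfl fun r _ => Finset.sum_congr rfl fun m _ =>
    Finset.sum_congr rfl fun J _ => ?_
  rw [Derivation.leibniz, Derivation.leibniz, Derivation.leibniz, D.map_algebraMap,
    Derivation.leibniz_finset_prod]
  simp only [smul_eq_mul]
  ring

/-- Otherwise some functional `u ≠ 0` kills the value at every tuple of forms. Take the `d`-th power
of the linear form `a` in a slot `r` with `β r ≠ 0`, and zero elsewhere: the result is `β_r d! ⟨a,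
u⟩ ∏ ⟨a, x^{(k)}⟩`, which is nonzero for suitable `a`. -/
theorem span_tensorForm_eq_top (hd : 1 ≤ d) (β : Fin R → K) (x : Fin (d - 1) → Fin n → K)
    (hβ : β ≠ 0) (hx : ∀ k, x k ≠ 0) :
    Submodule.span K (Set.range fun p : Fin R × FormMonomial n d =>
      tensorForm (Pi.single p 1) β x) = ⊤ := by
  have : CharZero K := algebraRat.charZero K
  by_contra hne
  obtain ⟨φ, hφ, hle⟩ := Submodule.exists_le_ker_of_lt_top _ (lt_top_iff_ne_top.2 hne)
  obtain ⟨r, hr⟩ := Function.ne_iff.1 hβ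
  let u : Fin n → K := fun i => φ (Pi.single i 1)
  have hφu : ∀ y, φ y = ∑ i, y i * u i := by
    intro y
    conv_lhs => rw [← Finset.univ_sum_single y, map_sum]
    refine Finset.sum_congr rfl fun i _ => ?_
    rw [show (Pi.single i (y i) : Fin n → K) = y i • Pi.single i 1 by
      rw [← Pi.single_smul]; simp, map_smul, smul_eq_mul]
  have hu : u ≠ 0 := by
    intro h
    exact hφ (LinearMap.ext fun y => by simp [hφu, h])
  obtain ⟨a, ha⟩ := exists_forall_sum_mul_ne_zero (fun o : Option (Fin (d - 1)) => o.elim u x)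
    (by rintro (_ | k); exacts [hu, hx k])
  let f : Fin R → MvPolynomial (Fin n) K := Pi.single r (linearForm a ^ d)
  have hf : ∀ r', (f r').IsHomogeneous d := by
    intro r'
    simp only [f, Pi.single_apply]
    split_ifs
    · exact isHomogeneous_linearForm_pow a d
    · exact isHomogeneous_zero _ _ _
  have hsum : ∑ r', C (β r') * f r' = β r • linearForm a ^ d := by
    simp [f, Pi.single_apply, smul_eq_C_mul]
  have h0 : φ (tensorForm (fun p => coeff p.2.1 (f p.1)) β x) = 0 := by
    rw [show tensorForm (fun p : Fin R × FormMonomial n d => coeff p.2.1 (f p.1)) β x =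
        ∑ p, coeff p.2.1 (f p.1) • tensorForm (Pi.single p 1) β x by
      ext i
      rw [tensorForm_eq_sum_coeff]
      simp, map_sum]
    refine Finset.sum_eq_zero fun p _ => ?_
    rw [map_smul, show φ _ = 0 from hle (Submodule.subset_span ⟨p, rfl⟩), smul_zero]
  have heval : ∀ i, tensorForm (fun p : Fin R × FormMonomial n d => coeff p.2.1 (f p.1)) β x i =
      β r * (d.factorial * a i * ∏ k, ∑ j, a j * x k j) := by
    intro i
    rw [← multilinEval_linearForm_pow hd, ← multilinEval_eq_tensorForm f hf, hsum,
      multilinEval_eq_sum, multilinEval_eq_sum, Finset.mul_sum]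
    refine Finset.sum_congr rfl fun J _ => ?_
    rw [map_smul, smul_eq_mul, mul_assoc]
  rw [hφu] at h0
  simp only [heval] at h0
  have h1 : β r * d.factorial * (∏ k, ∑ j, a j * x k j) * (∑ i, a i * u i) = 0 := by
    rw [← h0, Finset.mul_sum]
    refine Finset.sum_congr rfl fun i _ => ?_
    ring
  have hd0 : (d.factorial : K) ≠ 0 := Nat.cast_ne_zero.2 d.factorial_ne_zero
  exact mul_ne_zero (mul_ne_zero (mul_ne_zero hr hd0)
    (Finset.prod_ne_zero_iff.2 fun k _ => ha (some k))) (ha none) h1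

/-- A dimension count: differentiating the equation of a zero along each coefficient shows that `T`
and `J` together have full range, while `β` lies in the kernel of `T`. -/
theorem not_hasDegenerateZero_of_derivations (hd : 1 ≤ d) (a : Fin R × FormMonomial n d → K)
    (hD : ∀ p, ∃ D : Derivation ℚ K K, ∀ q, D (a q) = Pi.single (M := fun _ => K) p 1 q) :
    ¬ HasDegenerateZero (n + 1 - R) a := by
  rintro ⟨β, x, hβ, hx, h0, hrank⟩
  let T := tensorFormLinear a x
  let J := tensorJacobian a β x
  have htop : LinearMap.range T ⊔ LinearMap.range J.mulVecLin = ⊤ := by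
    rw [eq_top_iff, ← span_tensorForm_eq_top hd β x hβ hx, Submodule.span_le]
    rintro _ ⟨p, rfl⟩
    obtain ⟨D, hDp⟩ := hD p
    have key : tensorForm (Pi.single p 1) β x =
        -(T (fun r => D (β r)) + J.mulVecLin fun q => D (x q.1 q.2)) := by
      ext i
      have h := derivation_tensorForm D a β x i
      rw [congrFun h0 i, Pi.zero_apply, map_zero, _root_.funext hDp, add_assoc] at h
      exact eq_neg_of_add_eq_zero_left h.symm
    simp only [key]
    exact Submodule.neg_mem _ (Submodule.add_mem_sup ⟨_, rfl⟩ ⟨_, rfl⟩)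
  have hker : 0 < Module.finrank K (LinearMap.ker T) :=
    Module.finrank_pos_iff_exists_ne_zero.2 ⟨⟨β, h0⟩, fun h => hβ (congrArg Subtype.val h)⟩
  have hTn := LinearMap.finrank_range_add_finrank_ker T
  have hle := Submodule.finrank_add_le_finrank_add_finrank (LinearMap.range T)
    (LinearMap.range J.mulVecLin)
  rw [htop, finrank_top, Module.finrank_fin_fun] at hle
  rw [Module.finrank_fin_fun] at hTn
  have hrk : J.rank = Module.finrank K (LinearMap.range J.mulVecLin) := rfl
  change J.rank < _ at hrank
  -- `n ≤ rank T + rank J` and `rank T ≤ R - 1` contradict `rank J < n + 1 - R`.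
  omega

end GenericPoint

/-! ### From `σ*` to degenerate zeros, and the conclusion. -/

theorem sigmaStar_le_iff {F : Type*} [Field F] [CharZero F] {n R d : ℕ} (hnR : R ≤ n)
    (H : Fin R → MvPolynomial (Fin n) F) (hH : ∀ r, (H r).IsHomogeneous d) :
    sigmaStar d H ≤ (R : EReal) - 1 ↔ ¬ HasDegenerateZero (K := AlgebraicClosure F) (n + 1 - R)
      fun p : Fin R × FormMonomial n d => algebraMap F _ (coeff p.2.1 (H p.1)) := by
  have heval : ∀ β (x : Fin (d - 1) → Fin n → AlgebraicClosure F),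
      multilinEval d (linComb β H) x = tensorForm (fun p : Fin R × FormMonomial n d =>
        algebraMap F _ (coeff p.2.1 (H p.1))) β x := by
    intro β x
    ext i
    rw [linComb, multilinEval_eq_tensorForm _ (fun r => (hH r).map _)]
    simp only [coeff_map]
  have hjac : ∀ β (x : Fin (d - 1) → Fin n → AlgebraicClosure F),
      multilinJacobian d (linComb β H) x = tensorJacobian (fun p : Fin R × FormMonomial n d =>
        algebraMap F _ (coeff p.2.1 (H p.1))) β x := by
    intro β x
    ext i q
    rw [multilinJacobian_eq, heval]
    rfl
  -- `R ≤ n` keeps the natural subtraction from truncating; `I = ⊤` is the empty minimum.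
  have hcast : ∀ I : EReal, (n : EReal) - I ≤ (R : EReal) - 1 ↔ ((n + 1 - R : ℕ) : EReal) ≤ I := by
    intro I
    have h1 : (R : EReal) - 1 = ((R - 1 : ℝ) : EReal) := by
      rw [EReal.coe_sub]; rfl
    have h2 : ((n + 1 - R : ℕ) : EReal) = ((n + 1 - R : ℝ) : EReal) := by
      rw [← Nat.cast_add_one, ← Nat.cast_sub (by omega)]; rfl
    have h3 : (n : EReal) = ((n : ℝ) : EReal) := rfl
    rw [h1, h2, h3]
    induction I with
    | bot =>
      rw [EReal.coe_sub_bot, top_le_iff, le_bot_iff]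
      simp only [EReal.coe_ne_top, EReal.coe_ne_bot]
    | top => simp
    | coe c =>
      rw [← EReal.coe_sub, EReal.coe_le_coe_iff, EReal.coe_le_coe_iff]
      constructor <;> intro h <;> linarith
  rw [sigmaStar, hcast]
  simp only [le_iInf_iff, heval, hjac, HasDegenerateZero, Nat.cast_le]
  push Not
  exact ⟨fun h β x hβ => h β hβ x, fun h β hβ x => h β x hβ⟩

end GeneralPosition

end

theorem proposition1p4 (d n R : ℕ) (hd : 2 ≤ d) (hnR : R ≤ n) :
    ∃ U : Set (GeneralPosition.FormSpace d n R), IsOpen U ∧ U.Nonempty ∧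
      ∀ (F : Type u) [Field F] [CharZero F] (H : Fin R → MvPolynomial (Fin n) F),
        (∀ r, (H r).IsHomogeneous d) →
          (GeneralPosition.formPoint d H ∈ U ↔
            GeneralPosition.sigmaStar d H ≤ (R : EReal) - 1) := by
  classical
  obtain ⟨S, hS⟩ := GeneralPosition.exists_elimination_hasDegenerateZero.{u} d n R (n + 1 - R)
  refine ⟨{P | ∃ p ∈ S, p ∉ P.asIdeal}, ?_, ?_, ?_⟩
  · rw [show {P : GeneralPosition.FormSpace d n R | ∃ p ∈ S, p ∉ P.asIdeal} =
        (PrimeSpectrum.zeroLocus S)ᶜ by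
      ext P
      simp [PrimeSpectrum.mem_zeroLocus, Set.not_subset]]
    exact (PrimeSpectrum.isClosed_zeroLocus S).isOpen_compl
  -- The lift places `L` in the universe `u` over which `hS` quantifies.
  · let τ := ULift.{u} (Fin R × GeneralPosition.FormMonomial n d)
    let L := AlgebraicClosure (FractionRing (MvPolynomial τ ℚ))
    let a : Fin R × GeneralPosition.FormMonomial n d → L := fun p =>
      algebraMap (MvPolynomial τ ℚ) L (MvPolynomial.X (ULift.up p))
    have hgen : ¬ GeneralPosition.HasDegenerateZero (n + 1 - R) a := by
      refine GeneralPosition.not_hasDegenerateZero_of_derivations (by omega) a fun p => ?_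
      obtain ⟨D, hD⟩ := GeneralPosition.exists_derivation_dual_to_coordinate τ (ULift.up p)
      refine ⟨D, fun q => ?_⟩
      rw [hD, Pi.single_apply, Pi.single_apply]
      exact if_congr ⟨congrArg ULift.down, congrArg ULift.up⟩ rfl rfl
    rw [← hS] at hgen
    push Not at hgen
    obtain ⟨p, hp, hpa⟩ := hgen
    -- The generic point lies in the open set because `p` does not vanish at `a` and so is nonzero.
    refine ⟨⟨⊥, Ideal.isPrime_bot⟩, p, hp, fun h => hpa ?_⟩
    rw [show p = 0 from h, map_zero]
  · intro F _ _ H hH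
    rw [GeneralPosition.sigmaStar_le_iff hnR H hH, ← hS]
    push Not
    refine exists_congr fun p => and_congr_right fun _ => not_congr ?_
    change MvPolynomial.aeval _ p = 0 ↔ _
    -- Vanishing of `p` at the coefficients can be tested in the algebraic closure, as `F` embeds in
    -- it.
    rw [← map_eq_zero (algebraMap F (AlgebraicClosure F)), ← MvPolynomial.aeval_algebraMap_apply]
    rfl
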